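/- All matrices are real, and all graphs are simple, undirected and finite. For a graph $G$ with vertex set $\{1,\dots,n\}$ let $\mathcal S(G)$ be the set of real symmetric $n\times n$ matrices $A=[a_{ij}]$ such that, for all $i\ne j$, $a_{ij}\neq 0$ if and only if $ij$ is an edge of $G$ (the diagonal entries are arbitrary). A symmetric matrix $A$ has the Strong Spectral Property (SSP) if the only symmetric matrix $X$ with $A\circ X=O$, $I\circ X=O$ and $AX-XA=O$ is $X=O$, where $\circ$ denotes the entrywise product. The support $\operatorname{supp}(\mathbf x)$ of a vector $\mathbf x$ is the set of indices of its nonzero coordinates. **Augmentation Lemma.** Let $G$ be a graph on vertices $\{1,\dots,n\}$ and let $A\in\mathcal S(G)$ have the SSP. Let $\lambda$ be an eigenvalue of $A$ with multiplicity $k\ge 1$. Suppose that $\alpha\subseteq\{1,\dots,n\}$ has cardinality $k+1$ and that $|\operatorname{supp}(\mathbf x)\cap\alpha|\ge 2$ for every eigenvector $\mathbf x$ of $A$ corresponding to $\lambda$. Let $H$ be the graph on $\{1,\dots,n+1\}$ obtained from $G$ by appending the vertex $n+1$, adjacent exactly to the vertices in $\alpha$. Then there exists a matrix $A'\in\mathcal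 S(H)$ such that $A'$ has the SSP, $\lambda$ is an eigenvalue of $A'$ with multiplicity $k+1$, and every real $\mu\neq\lambda$ has the same multiplicity (possibly $0$) as an eigenvalue of $A'$ as of $A$. -/

import Mathlib

open scoped Matrix

namespace IEPG

/-- The graph of a symmetric matrix `A`: distinct `i`, `j` are adjacent iff `A i j ≠ 0`
(`fromRel` symmetrises the relation and drops loops; the former changes nothing as `A` is
symmetric wherever this is used). -/
def matrixGraph {V : Type*} (A : Matrix V V ℝ) : SimpleGraph V :=
  SimpleGraph.fromRel fun i j => A i j ≠ 0

/-- `S(G)`: the real symmetric matrices whose graph is `G` (the diagonal is free). -/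
def symMatricesOf {V : Type*} (G : SimpleGraph V) : Set (Matrix V V ℝ) :=
  {A | A.IsSymm ∧ matrixGraph A = G}

/-- The Strong Spectral Property of a real symmetric matrix. -/
def HasSSP {V : Type*} [Fintype V] [DecidableEq V] (A : Matrix V V ℝ) : Prop :=
  A.IsSymm ∧ ∀ X : Matrix V V ℝ, X.IsSymm →
    A ⊙ X = 0 → (1 : Matrix V V ℝ) ⊙ X = 0 → ⁅A, X⁆ = 0 → X = 0

/-- The multiplicity of `μ` as an eigenvalue of `A` (zero if `μ` is not an eigenvalue). -/
noncomputable def eigMult {V : Type*} [Fintype V] [DecidableEq V]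
    (A : Matrix V V ℝ) (μ : ℝ) : ℕ :=
  A.charpoly.rootMultiplicity μ

/-- The graph obtained from `G` by appending one new vertex, the last one, adjacent exactly to
the vertices in `α`; the old vertices are embedded by `Fin.castSucc`. -/
def appendVertex {n : ℕ} (G : SimpleGraph (Fin n)) (α : Finset (Fin n)) :
    SimpleGraph (Fin (n + 1)) where
  Adj i j :=
    (∃ a b, G.Adj a b ∧ i = Fin.castSucc a ∧ j = Fin.castSucc b) ∨
    (∃ a ∈ α, i = Fin.castSucc a ∧ j = Fin.last n) ∨
    (∃ b ∈ α, i = Fin.last n ∧ j = Fin.castSucc b)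
  symm := ⟨by
    rintro i j (⟨a, b, h, rfl, rfl⟩ | ⟨a, h, rfl, rfl⟩ | ⟨b, h, rfl, rfl⟩)
    · exact Or.inl ⟨b, a, h.symm, rfl, rfl⟩
    · exact Or.inr (Or.inr ⟨a, h, rfl, rfl⟩)
    · exact Or.inr (Or.inl ⟨b, h, rfl, rfl⟩)⟩
  loopless := ⟨by
    rintro i (⟨a, b, h, rfl, hb⟩ | ⟨a, -, rfl, h⟩ | ⟨b, -, rfl, h⟩)
    · exact h.ne (Fin.castSucc_injective n hb)
    · exact (Fin.castSucc_lt_last a).ne h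
    · exact (Fin.castSucc_lt_last b).ne h.symm⟩

end IEPG

namespace IEPG

open Filter Topology

/-! ### Implicit function theorem on conjugation orbits; openness of injectivity. -/

section Analysis

variable {R F : Type*} [NormedRing R] [NormedAlgebra ℝ R] [FiniteDimensional ℝ R]
  [NormedAddCommGroup F] [NormedSpace ℝ F] [FiniteDimensional ℝ F]

/-! Start from M = A ⊕ [λ], which already has the required spectrum, and move it along its
orthogonal conjugation orbit until the entries at `α` become nonzero. The SSP of A, together with
the fact that no λ-eigenvector vanishes on `α`, makes M strong relative to the pattern of H,
although M is zero at the new edges (`isStrong_bordered`). By duality, strength says that the orbit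
of M meets the space of pattern matrices transversally, so any commutator [M, K] with K skew that
respects the pattern is the velocity of an isospectral curve inside the pattern
(`IsStrong.exists_isospectral_curve`).

The hypothesis on supports gives a vector w orthogonal to the λ-eigenspace with support exactly `α`
(`exists_orthogonal_support_eq`). Hence w = (A - λ)u for some u, and the skew matrix built from u
has as commutator with M the border w. Along the resulting curve, for small t ≠ 0, the entries at
`α` are nonzero by their derivative, the old edges survive by continuity, and strength persists
because it is an open condition. -/

omit [FiniteDimensional ℝ R] in
theorem hasStrictFDerivAt_exp_conj [CompleteSpace R] (m : R) :
    HasStrictFDerivAt (fun x : R => NormedSpace.exp (-x) * m * NormedSpace.exp x)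
      ((ContinuousLinearMap.mul ℝ R m) - (ContinuousLinearMap.mul ℝ R).flip m) 0 := by
  have h1 : HasStrictFDerivAt (NormedSpace.exp : R → R) (1 : R →L[ℝ] R) 0 :=
    hasStrictFDerivAt_exp_zero
  have h2 : HasStrictFDerivAt (fun x : R => NormedSpace.exp (-x)) (-1 : R →L[ℝ] R) 0 := by
    have h1' : HasStrictFDerivAt (NormedSpace.exp : R → R) (1 : R →L[ℝ] R) (-0) := by
      simpa using h1
    have := h1'.comp (0 : R) (hasStrictFDerivAt_id (𝕜 := ℝ) (0 : R)).neg
    convert! this using 1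
  have := (h2.mul_const' m).mul' h1
  convert! this using 1
  ext x
  simp [sub_eq_add_neg]

/-- A curve on an orbit of conjugation, in a prescribed affine slice, with prescribed velocity. -/
theorem exists_curve_of_surjective (m : R) (σ : R →ₗ[ℝ] R) (s : F →ₗ[ℝ] R)
    (hsurj : ∀ y, ∃ x z, m * σ x - σ x * m + s z = y)
    (z₀ : F) (hz₀ : m + s z₀ = 0) (x₁ : R) (z₁ : F) (h₁ : m * σ x₁ - σ x₁ * m + s z₁ = 0) :
    ∃ (a : ℝ → R) (z : ℝ → F), z 0 = z₀ ∧
      (∀ l : F →ₗ[ℝ] ℝ, HasDerivAt (fun t => l (z t)) (l z₁) 0) ∧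
      ∀ᶠ t in 𝓝 0, NormedSpace.exp (-σ (a t)) * m * NormedSpace.exp (σ (a t)) + s (z t) = 0 := by
  have : CompleteSpace R := FiniteDimensional.complete ℝ R
  have : CompleteSpace F := FiniteDimensional.complete ℝ F
  set σ' : R →L[ℝ] R := LinearMap.toContinuousLinearMap σ
  set s' : F →L[ℝ] R := LinearMap.toContinuousLinearMap s
  set f : R × F → R := fun p =>
    NormedSpace.exp (-σ p.1) * m * NormedSpace.exp (σ p.1) + s p.2 with hf
  set f' : R × F →L[ℝ] R :=
    (((ContinuousLinearMap.mul ℝ R m) - (ContinuousLinearMap.mul ℝ R).flip m).comp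
      (σ'.comp (ContinuousLinearMap.fst ℝ R F))) + s'.comp (ContinuousLinearMap.snd ℝ R F) with hf'
  have hf'_apply : ∀ p, f' p = m * σ p.1 - σ p.1 * m + s p.2 := fun p => by
    simp [hf', σ', s']
  have hfa : f (0, z₀) = 0 := by simp [hf, hz₀]
  have hd : HasStrictFDerivAt f f' (0, z₀) := by
    have h1 : HasStrictFDerivAt (fun p : R × F => σ' p.1)
        (σ'.comp (ContinuousLinearMap.fst ℝ R F)) (0, z₀) :=
      (σ'.comp (ContinuousLinearMap.fst ℝ R F)).hasStrictFDerivAt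
    have h2 : HasStrictFDerivAt (fun p : R × F => s' p.2)
        (s'.comp (ContinuousLinearMap.snd ℝ R F)) (0, z₀) :=
      (s'.comp (ContinuousLinearMap.snd ℝ R F)).hasStrictFDerivAt
    have h3 : HasStrictFDerivAt (fun x : R => NormedSpace.exp (-x) * m * NormedSpace.exp x)
      ((ContinuousLinearMap.mul ℝ R m) - (ContinuousLinearMap.mul ℝ R).flip m)
      (σ' ((0, z₀) : R × F).1) := by
      simpa using hasStrictFDerivAt_exp_conj m
    exact (h3.comp ((0, z₀) : R × F) h1).add h2
  have hr : f'.range = ⊤ := by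
    rw [LinearMap.range_eq_top]
    intro y
    obtain ⟨x, z, h⟩ := hsurj y
    exact ⟨(x, z), (hf'_apply _).trans h⟩
  have hk : (x₁, z₁) ∈ f'.ker := by
    rw [LinearMap.mem_ker]
    exact (hf'_apply _).trans h₁
  -- The curve is the image of the line spanned by this kernel vector under the implicit function,
  -- whose derivative at 0 is the inclusion of the kernel.
  set v : f'.ker := ⟨(x₁, z₁), hk⟩
  set g := hd.implicitFunction f f' hr (f (0, z₀))
  have hg : HasStrictFDerivAt g f'.ker.subtypeL 0 := hd.to_implicitFunction hr
  have hev := hd.map_implicitFunction_eq hr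
  have hline : HasDerivAt (fun t : ℝ => t • v) v 0 := by
    simpa using (hasDerivAt_id (0 : ℝ)).smul_const v
  have hc : HasDerivAt (fun t : ℝ => g (t • v)) (x₁, z₁) 0 := by
    have hg' : HasFDerivAt g f'.ker.subtypeL ((0 : ℝ) • v) := by simpa using hg.hasFDerivAt
    exact hg'.comp_hasDerivAt (0 : ℝ) hline
  have hg0 : g 0 = (0, z₀) := by
    exact hd.implicitFunction_apply_image hr
  refine ⟨fun t => (g (t • v)).1, fun t => (g (t • v)).2, by simp [hg0], fun l => ?_, ?_⟩
  · have := ((LinearMap.toContinuousLinearMap l).comp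
      (ContinuousLinearMap.snd ℝ R F)).hasFDerivAt.comp_hasDerivAt (0 : ℝ) hc
    exact this
  · have ht : Tendsto (fun t : ℝ => (f (0, z₀), t • v)) (𝓝 0) (𝓝 (f (0, z₀), 0)) := by
      have : Continuous (fun t : ℝ => (f (0, z₀), t • v)) := by fun_prop
      simpa using this.tendsto 0
    filter_upwards [ht.eventually hev] with t h
    have h' : f (g (t • v)) = f (0, z₀) := h
    exact h'.trans hfa

-- The condition is injectivity of x ↦ (s x, bx - xb), a linear map depending continuously on b, and
-- injectivity is open in finite dimension.
omit [FiniteDimensional ℝ F] in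
theorem eventually_forall_commute_eq_zero (m : R) (s : R →ₗ[ℝ] F)
    (h : ∀ x, s x = 0 → m * x = x * m → x = 0) :
    ∀ᶠ b in 𝓝 m, ∀ x, s x = 0 → b * x = x * b → x = 0 := by
  set T : R → (R →L[ℝ] F × R) := fun b => (LinearMap.toContinuousLinearMap s).prod
    (ContinuousLinearMap.mul ℝ R b - (ContinuousLinearMap.mul ℝ R).flip b) with hT
  have hinj : ∀ b, Function.Injective (T b) ↔ ∀ x, s x = 0 → b * x = x * b → x = 0 := by
    intro b
    rw [injective_iff_map_eq_zero]
    simp [hT, sub_eq_zero]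
  have hTc : Continuous T := by
    have : T = fun b => (LinearMap.toContinuousLinearMap s).prod 0 +
        (ContinuousLinearMap.inr ℝ F R).comp
          (ContinuousLinearMap.mul ℝ R b - (ContinuousLinearMap.mul ℝ R).flip b) := by
      ext b x <;> simp [hT]
    rw [this]
    fun_prop
  have := (ContinuousLinearMap.isOpen_injective (𝕜 := ℝ) (E := R) (F := F × R)).preimage hTc
  filter_upwards [this.mem_nhds ((hinj m).2 h)] with b hb
  exact (hinj b).1 hb

end Analysis

/-! ### Linear algebra: eigenspaces, supports and the trace pairing. -/

theorem finrank_eigenspace_toLin' {V : Type*} [Fintype V] [DecidableEq V] {A : Matrix V V ℝ}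
    (hA : A.IsSymm) (μ : ℝ) :
    Module.finrank ℝ (Module.End.eigenspace (Matrix.toLin' A) μ) = eigMult A μ := by
  have hsym : A.toEuclideanLin.IsSymmetric :=
    Matrix.isSymmetric_toEuclideanLin_iff.2 (by
      rw [Matrix.IsHermitian, Matrix.conjTranspose_eq_transpose_of_trivial]; exact hA)
  set e := WithLp.linearEquiv 2 ℝ (V → ℝ) with he
  have hconj : e.conj A.toEuclideanLin = Matrix.toLin' A := by
    ext; rfl
  have h1 := LinearMap.finrank_maxGenEigenspace_eq A.toEuclideanLin μ
  have h3 : A.toEuclideanLin.charpoly = A.charpoly := by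
    rw [← LinearEquiv.charpoly_conj e, hconj, Matrix.charpoly_toLin']
  rw [hsym.isFinitelySemisimple.maxGenEigenspace_eq_eigenspace, h3] at h1
  have : (Module.End.eigenspace (Matrix.toLin' A) μ) =
      (Module.End.eigenspace A.toEuclideanLin μ).map (e : _ →ₗ[ℝ] _) := by
    ext x
    rw [Submodule.mem_map_equiv, Module.End.mem_eigenspace_iff, Module.End.mem_eigenspace_iff,
      ← hconj, LinearEquiv.conj_apply_apply, ← e.symm.injective.eq_iff]
    simp
  rw [eigMult, ← h1, this]
  exact LinearEquiv.finrank_map_eq e _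

/-- Restriction of E to `α` cannot be onto, by dimension, so a nonzero functional on `α` kills its
image; this is w. Restriction to `α` minus one point i is injective by the support hypothesis, hence
bijective, so w i = 0 would force w = 0. -/
theorem exists_orthogonal_support_eq {V : Type*} [Fintype V] [DecidableEq V]
    (E : Submodule ℝ (V → ℝ)) (α : Finset V) (hcard : α.card = Module.finrank ℝ E + 1)
    (hα : ∀ x ∈ E, x ≠ 0 → 2 ≤ (Function.support x ∩ (α : Set V)).ncard) :
    ∃ w : V → ℝ, (∀ i, w i ≠ 0 ↔ i ∈ α) ∧ ∀ x ∈ E, w ⬝ᵥ x = 0 := by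
  let res (β : Finset V) : E →ₗ[ℝ] (β → ℝ) := (LinearMap.funLeft ℝ ℝ Subtype.val).comp E.subtype
  have hlt : LinearMap.range (res α) < ⊤ := by
    refine lt_top_iff_ne_top.2 fun h => ?_
    have h1 := LinearMap.finrank_range_le (res α)
    rw [h, finrank_top, Module.finrank_fintype_fun_eq_card, Fintype.card_coe] at h1
    omega
  obtain ⟨φ, hφ0, hφ⟩ := Submodule.exists_le_ker_of_lt_top _ hlt
  set w : V → ℝ := fun i => if h : i ∈ α then φ (Pi.single ⟨i, h⟩ 1) else 0 with hw
  have hwx : ∀ x : V → ℝ, w ⬝ᵥ x = φ fun i => x i := by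
    intro x
    have h1 : (fun i : α => x i) = ∑ i : α, x i • (Pi.single i 1 : α → ℝ) := by
      ext j
      simp [Finset.sum_apply, Pi.single_apply]
    rw [h1, map_sum, dotProduct, ← Finset.sum_subset (Finset.subset_univ α)
      (fun i _ hi => by simp [hw, hi]), ← Finset.sum_coe_sort α]
    refine Finset.sum_congr rfl fun i _ => ?_
    simp [hw, mul_comm]
  have horth : ∀ x ∈ E, w ⬝ᵥ x = 0 := by
    intro x hx
    rw [hwx]
    exact hφ ⟨⟨x, hx⟩, rfl⟩
  refine ⟨w, fun i => ⟨fun h => by by_contra hi; simp [hw, hi] at h, fun hi h0 => hφ0 ?_⟩, horth⟩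
  have hinj : Function.Injective (res (α.erase i)) := by
    rw [injective_iff_map_eq_zero]
    intro x hx
    by_contra hne
    have h2 := hα x x.2 (by simpa using hne)
    have hsub : Function.support (x : V → ℝ) ∩ (α : Set V) ⊆ {i} := by
      rintro j ⟨hj, hjα⟩
      by_contra hji
      exact hj (congrFun hx ⟨j, Finset.mem_erase.2 ⟨hji, hjα⟩⟩)
    have h3 := Set.ncard_le_ncard hsub (Set.finite_singleton i)
    rw [Set.ncard_singleton] at h3
    omega
  have hsurj : Function.Surjective (res (α.erase i)) := by
    refine (LinearMap.injective_iff_surjective_of_finrank_eq_finrank ?_).1 hinj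
    rw [Module.finrank_fintype_fun_eq_card, Fintype.card_coe, Finset.card_erase_of_mem hi, hcard]
    rfl
  -- Since w i = 0, pairing w with a lift to E of the basis vector at j isolates w j.
  have hw0 : w = 0 := by
    ext j
    by_cases hj : j ∈ α.erase i
    · obtain ⟨x, hx⟩ := hsurj (Pi.single ⟨j, hj⟩ 1)
      have h4 := horth x x.2
      rw [dotProduct, Finset.sum_eq_single j] at h4
      · have : (x : V → ℝ) j = 1 := by
          have := congrFun hx ⟨j, hj⟩
          simpa [res] using this
        simpa [this] using h4
      · intro l _ hlj
        by_cases hl : l ∈ α.erase i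
        · have := congrFun hx ⟨l, hl⟩
          have : (x : V → ℝ) l = 0 := by
            simpa [res, Pi.single_apply, hlj] using this
          simp [this]
        · have : w l = 0 := by
            by_cases hli : l = i
            · rw [hli, h0]
            · have : l ∉ α := fun h => hl (Finset.mem_erase.2 ⟨hli, h⟩)
              simp [hw, this]
          simp [this]
      · simp
    · by_cases hji : j = i
      · rw [hji, h0]; rfl
      · have : j ∉ α := fun h => hj (Finset.mem_erase.2 ⟨hji, h⟩)
        simp [hw, this]
  refine LinearMap.pi_ext' fun j => LinearMap.ext_ring ?_
  have := congrFun hw0 j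
  simpa [hw] using this

theorem exists_mulVec_eq_of_orthogonal_ker {V : Type*} [Fintype V] [DecidableEq V]
    {B : Matrix V V ℝ} (hB : B.IsSymm) {w : V → ℝ}
    (hw : ∀ x, B *ᵥ x = 0 → w ⬝ᵥ x = 0) : ∃ u, B *ᵥ u = w := by
  suffices w ∈ LinearMap.range B.mulVecLin from this
  rw [← Subspace.forall_mem_dualAnnihilator_apply_eq_zero_iff]
  intro φ hφ
  obtain ⟨x, rfl⟩ := (dotProductEquiv ℝ V).surjective φ
  have h0 : B *ᵥ x = 0 := by
    ext i
    have := (Submodule.mem_dualAnnihilator _).1 hφ _ ⟨Pi.single i 1, rfl⟩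
    rw [← hB.eq, Matrix.mulVec_transpose]
    have h : x ⬝ᵥ B.col i = 0 := by simpa using this
    exact h
  simpa [dotProduct_comm] using hw x h0

theorem exists_trace_mul_eq {V : Type*} [Fintype V] [DecidableEq V]
    (φ : Module.Dual ℝ (Matrix V V ℝ)) : ∃ X : Matrix V V ℝ, ∀ Y, φ Y = (X * Y).trace := by
  refine ⟨.of fun i j => φ (Matrix.single j i 1), fun Y => ?_⟩
  have : φ = (Matrix.traceLinearMap V ℝ ℝ).comp
      (LinearMap.mulLeft ℝ (.of fun i j => φ (Matrix.single j i 1))) := by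
    refine Matrix.ext_linearMap ℝ fun i j => LinearMap.ext_ring ?_
    simp [Matrix.trace_mul_single]
  exact LinearMap.congr_fun this Y

/-! ### Strong patterns: transversality, isospectral curves, openness. -/

/-- The strong property of `M` relative to an arbitrary pattern `r` of free entries. -/
def IsStrong {V : Type*} [Fintype V] (r : V → V → Prop) (M : Matrix V V ℝ) : Prop :=
  ∀ X : Matrix V V ℝ, X.IsSymm → (∀ i j, r i j → X i j = 0) → M * X = X * M → X = 0

open Classical in
/-- The projection of matrices onto the entries in `r`. -/
noncomputable def mask {V : Type*} (r : V → V → Prop) : Matrix V V ℝ →ₗ[ℝ] Matrix V V ℝ where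
  toFun B := .of fun i j => if r i j then B i j else 0
  map_add' B C := by ext i j; simp only [Matrix.of_apply, Matrix.add_apply]; split_ifs <;> simp
  map_smul' c B := by ext i j; simp

theorem mask_apply_of_rel {V : Type*} {r : V → V → Prop} {i j : V} (h : r i j)
    (B : Matrix V V ℝ) : mask r B i j = B i j := if_pos h

theorem mask_apply_of_not_rel {V : Type*} {r : V → V → Prop} {i j : V} (h : ¬ r i j)
    (B : Matrix V V ℝ) : mask r B i j = 0 := if_neg h

theorem mask_eq_self {V : Type*} {r : V → V → Prop} {B : Matrix V V ℝ}
    (h : ∀ i j, ¬ r i j → B i j = 0) : mask r B = B := by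
  ext i j
  by_cases hij : r i j
  · exact mask_apply_of_rel hij B
  · rw [mask_apply_of_not_rel hij, h i j hij]

theorem mask_transpose {V : Type*} {r : V → V → Prop} (hr : ∀ i j, r i j → r j i)
    (B : Matrix V V ℝ) : mask r Bᵀ = (mask r B)ᵀ := by
  ext i j
  by_cases hij : r i j
  · rw [Matrix.transpose_apply, mask_apply_of_rel hij, mask_apply_of_rel (hr _ _ hij)]; rfl
  · rw [Matrix.transpose_apply, mask_apply_of_not_rel hij,
      mask_apply_of_not_rel fun h => hij (hr _ _ h)]

/-- `K ↦ K - Kᵀ`. -/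
def skewPart (V : Type*) : Matrix V V ℝ →ₗ[ℝ] Matrix V V ℝ :=
  LinearMap.id - (Matrix.transposeLinearEquiv V V ℝ ℝ : Matrix V V ℝ →ₗ[ℝ] Matrix V V ℝ)

theorem skewPart_apply {V : Type*} (K : Matrix V V ℝ) : skewPart V K = K - Kᵀ := rfl

/-- `(W, B) ↦ W - Wᵀ - mask r (B + Bᵀ)`. -/
noncomputable def slack {V : Type*} (r : V → V → Prop) :
    Matrix V V ℝ × Matrix V V ℝ →ₗ[ℝ] Matrix V V ℝ :=
  (skewPart V).comp (LinearMap.fst ℝ _ _) -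
    ((mask r).comp (LinearMap.id +
      (Matrix.transposeLinearEquiv V V ℝ ℝ : Matrix V V ℝ →ₗ[ℝ] Matrix V V ℝ))).comp
      (LinearMap.snd ℝ _ _)

theorem slack_apply {V : Type*} (r : V → V → Prop) (W B : Matrix V V ℝ) :
    slack r (W, B) = W - Wᵀ - mask r (B + Bᵀ) := rfl

/-- A trace functional X annihilating the range is symmetric (test on W), vanishes on r (test on B)
and commutes with M (test on K), so strength makes it zero. -/
theorem IsStrong.surjective {V : Type*} [Fintype V] [DecidableEq V] {r : V → V → Prop}
    {M : Matrix V V ℝ} (h : IsStrong r M) (hr : ∀ i j, r i j → r j i) (hM : M.IsSymm)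
    (Y : Matrix V V ℝ) : ∃ K P, M * skewPart V K - skewPart V K * M + slack r P = Y := by
  let T : Matrix V V ℝ × (Matrix V V ℝ × Matrix V V ℝ) →ₗ[ℝ] Matrix V V ℝ :=
    ((LinearMap.mulLeft ℝ M - LinearMap.mulRight ℝ M).comp (skewPart V)).coprod (slack r)
  suffices Y ∈ LinearMap.range T by
    obtain ⟨⟨K, P⟩, h⟩ := this
    exact ⟨K, P, h⟩
  rw [← Subspace.forall_mem_dualAnnihilator_apply_eq_zero_iff]
  intro φ hφ
  obtain ⟨X, hX⟩ := exists_trace_mul_eq φ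
  have hT : ∀ K W B, (X * (M * (K - Kᵀ) - (K - Kᵀ) * M + (W - Wᵀ - mask r (B + Bᵀ)))).trace = 0 :=
    fun K W B => by
      rw [← hX]
      exact (Submodule.mem_dualAnnihilator _).1 hφ _ ⟨(K, (W, B)), rfl⟩
  have hXs : X.IsSymm := by
    refine Matrix.ext_iff_trace_mul_right.2 fun W => ?_
    have h1 := hT 0 W 0
    simp only [Matrix.transpose_zero, sub_zero, mul_zero, zero_mul, add_zero, map_zero, zero_add,
      mul_sub, Matrix.trace_sub] at h1
    rw [← Matrix.trace_transpose, Matrix.transpose_mul, Matrix.transpose_transpose,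
      Matrix.trace_mul_comm]
    linarith
  have hXr : ∀ i j, r i j → X i j = 0 := by
    intro i j hij
    have h1 := hT 0 0 (Matrix.single i j 1)
    have h2 : mask r (Matrix.single i j 1 + (Matrix.single i j (1 : ℝ))ᵀ) =
        Matrix.single i j 1 + Matrix.single j i 1 := by
      rw [Matrix.transpose_single]
      refine mask_eq_self fun a b hab => ?_
      have h3 : ¬ (i = a ∧ j = b) := by rintro ⟨rfl, rfl⟩; exact hab hij
      have h4 : ¬ (j = a ∧ i = b) := by rintro ⟨rfl, rfl⟩; exact hab (hr _ _ hij)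
      simp [h3, h4]
    rw [h2] at h1
    simp only [Matrix.transpose_zero, sub_zero, mul_zero, zero_mul, zero_add,
      zero_sub, mul_neg, Matrix.trace_neg, mul_add, Matrix.trace_add, Matrix.trace_mul_single,
      hXs.apply j i] at h1
    have h5 := hXs.apply j i
    simp at h1
    linarith
  have hXM : M * X = X * M := by
    have hC : X * M - M * X = 0 := by
      refine Matrix.ext_iff_trace_mul_right.2 fun K => ?_
      have h1 := hT K 0 0
      simp only [Matrix.transpose_zero, sub_zero, add_zero, map_zero] at h1
      have h2 : (X * (M * (K - Kᵀ) - (K - Kᵀ) * M)).trace =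
          ((X * M - M * X) * K).trace - ((X * M - M * X) * Kᵀ).trace := by
        have e1 : ∀ L : Matrix V V ℝ, (X * (M * L - L * M)).trace =
            ((X * M - M * X) * L).trace := by
          intro L
          rw [mul_sub, sub_mul, Matrix.trace_sub, Matrix.trace_sub, ← mul_assoc X L M,
            Matrix.trace_mul_comm (X * L) M, mul_assoc, mul_assoc]
        rw [e1, mul_sub, Matrix.trace_sub]
      have h3 : ((X * M - M * X) * Kᵀ).trace = -((X * M - M * X) * K).trace := by
        rw [← Matrix.trace_transpose, Matrix.transpose_mul, Matrix.transpose_transpose,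
          Matrix.transpose_sub, Matrix.transpose_mul, Matrix.transpose_mul, hXs.eq, hM.eq,
          Matrix.trace_mul_comm, ← Matrix.trace_neg, ← neg_mul, neg_sub]
      rw [h2, h3] at h1
      rw [zero_mul, Matrix.trace_zero]
      linarith
    exact (sub_eq_zero.1 hC).symm
  rw [hX, h X hXs hXr hXM]
  simp

theorem charpoly_orthogonal_conj {V : Type*} [Fintype V] [DecidableEq V] {U : Matrix V V ℝ}
    (hU : Uᵀ * U = 1) (M : Matrix V V ℝ) : (Uᵀ * M * U).charpoly = M.charpoly := by
  rw [Matrix.charpoly_mul_comm, ← mul_assoc, mul_eq_one_comm.1 hU, one_mul]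

open scoped Matrix.Norms.Operator in
/-- Along a skew direction whose commutator with `M` respects the pattern, the isospectral
symmetric matrices with this pattern contain a curve tangent to the commutator. -/
theorem IsStrong.exists_isospectral_curve {V : Type*} [Fintype V] [DecidableEq V]
    {r : V → V → Prop} {M : Matrix V V ℝ} (h : IsStrong r M) (hr : ∀ i j, r i j → r j i)
    (hM : M.IsSymm) (hMr : ∀ i j, ¬ r i j → M i j = 0) (K : Matrix V V ℝ)
    (hK : ∀ i j, ¬ r i j → (M * (K - Kᵀ) - (K - Kᵀ) * M) i j = 0) :
    ∃ γ : ℝ → Matrix V V ℝ, γ 0 = M ∧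
      (∀ i j, HasDerivAt (fun t => γ t i j) ((M * (K - Kᵀ) - (K - Kᵀ) * M) i j) 0) ∧
      ∀ᶠ t in 𝓝 0, (γ t).IsSymm ∧ (∀ i j, ¬ r i j → γ t i j = 0) ∧
        (γ t).charpoly = M.charpoly := by
  set D := M * (K - Kᵀ) - (K - Kᵀ) * M with hD
  have hDs : Dᵀ = D := by
    simp only [hD, Matrix.transpose_sub, Matrix.transpose_mul, Matrix.transpose_transpose, hM.eq]
    noncomm_ring
  have hhalf : ∀ B : Matrix V V ℝ, (2⁻¹ : ℝ) • B + (2⁻¹ : ℝ) • B = B := fun B => by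
    rw [← add_smul]; norm_num
  -- The halves compensate for the symmetrisation B + Bᵀ in `slack`, so that the curve starts at M
  -- with velocity D.
  obtain ⟨a, z, hz0, hz, hev⟩ := exists_curve_of_surjective M (skewPart V) (slack r)
    (h.surjective hr hM) (0, (2⁻¹ : ℝ) • M)
    (by
      rw [slack_apply, Matrix.transpose_smul, hM.eq, hhalf, mask_eq_self hMr]
      simp) K (0, (2⁻¹ : ℝ) • D)
    (by
      rw [slack_apply, Matrix.transpose_smul, hDs, hhalf, mask_eq_self hK, skewPart_apply, ← hD]
      simp)
  let E : Matrix V V ℝ →ₗ[ℝ] Matrix V V ℝ := (mask r).comp (LinearMap.id +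
      (Matrix.transposeLinearEquiv V V ℝ ℝ : Matrix V V ℝ →ₗ[ℝ] Matrix V V ℝ))
  have hE : ∀ B, E B = mask r (B + Bᵀ) := fun B => rfl
  refine ⟨fun t => E (z t).2, ?_, fun i j => ?_, ?_⟩
  · simp only [hz0, hE, Matrix.transpose_smul, hM.eq, hhalf, mask_eq_self hMr]
  · have h1 := hz ((Matrix.entryLinearMap ℝ ℝ i j).comp (E.comp (LinearMap.snd ℝ _ _)))
    have h2 : E ((2⁻¹ : ℝ) • D) = D := by
      rw [hE, Matrix.transpose_smul, hDs, hhalf, mask_eq_self hK]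
    have h3 : (Matrix.entryLinearMap ℝ ℝ i j).comp (E.comp (LinearMap.snd ℝ _ _))
        ((0 : Matrix V V ℝ), (2⁻¹ : ℝ) • D) = D i j := by
      change E ((2⁻¹ : ℝ) • D) i j = D i j
      rw [h2]
    rw [h3] at h1
    exact h1
  · filter_upwards [hev] with t ht
    set S := skewPart V (a t) with hS
    have hSt : Sᵀ = -S := by simp [hS, skewPart_apply]
    have hsymm : (E (z t).2)ᵀ = E (z t).2 := by
      rw [hE, ← mask_transpose hr, Matrix.transpose_add, Matrix.transpose_transpose, add_comm]
    set u := NormedSpace.exp S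
    have hut : NormedSpace.exp (-S) = uᵀ := by rw [← hSt, Matrix.exp_transpose]
    have huu : uᵀ * u = 1 := by
      rw [← hut, ← Matrix.exp_add_of_commute _ _ (Commute.refl S).neg_left]
      simp
    have heq : uᵀ * M * u + ((z t).1 - (z t).1ᵀ - E (z t).2) = 0 := by
      rw [← hut]; exact ht
    have heq' : uᵀ * M * u + ((z t).1ᵀ - (z t).1 - E (z t).2) = 0 := by
      have := congrArg Matrix.transpose heq
      simpa only [Matrix.transpose_add, Matrix.transpose_sub, Matrix.transpose_mul,
        Matrix.transpose_transpose, Matrix.transpose_zero, hM.eq, hsymm, mul_assoc] using this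
    -- Adding the equation to its transpose cancels the auxiliary skew term.
    have hfin : E (z t).2 = uᵀ * M * u := by
      ext i j
      have e1 := congrFun (congrFun heq i) j
      have e2 := congrFun (congrFun heq' i) j
      simp only [Matrix.add_apply, Matrix.sub_apply, Matrix.zero_apply] at e1 e2
      linarith
    refine ⟨hsymm, fun i j hij => mask_apply_of_not_rel hij _, ?_⟩
    rw [hfin]
    exact charpoly_orthogonal_conj huu M

open scoped Matrix.Norms.Operator in
theorem IsStrong.eventually {V : Type*} [Fintype V] [DecidableEq V]
    {r : V → V → Prop} {M : Matrix V V ℝ} (h : IsStrong r M) (γ : ℝ → Matrix V V ℝ)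
    (hγ0 : γ 0 = M) (hγ : ∀ i j, ContinuousAt (fun t => γ t i j) 0) :
    ∀ᶠ t in 𝓝 0, IsStrong r (γ t) := by
  have hc : Tendsto γ (𝓝 0) (𝓝 M) := by
    rw [← hγ0]
    exact tendsto_pi_nhds.2 fun i => tendsto_pi_nhds.2 fun j => hγ i j
  have hker : ∀ X, (skewPart V).prod (mask r) X = 0 ↔ X.IsSymm ∧ ∀ i j, r i j → X i j = 0 := by
    intro X
    change (skewPart V X, mask r X) = 0 ↔ _
    rw [Prod.mk_eq_zero, skewPart_apply, sub_eq_zero, eq_comm]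
    refine and_congr Iff.rfl ⟨fun h i j hij => ?_, fun h => ?_⟩
    · rw [← mask_apply_of_rel hij X, h]; rfl
    · ext i j
      by_cases hij : r i j
      · rw [mask_apply_of_rel hij, h i j hij]; rfl
      · exact mask_apply_of_not_rel hij X
  have := eventually_forall_commute_eq_zero M ((skewPart V).prod (mask r))
    fun X hX => h X ((hker X).1 hX).1 ((hker X).1 hX).2
  filter_upwards [hc.eventually this] with t ht X hXs hXr hXM
  exact ht X ((hker X).2 ⟨hXs, hXr⟩) hXM

/-! ### The SSP as strength relative to the graph's pattern. -/

theorem mem_symMatricesOf_iff {V : Type*} {G : SimpleGraph V} {A : Matrix V V ℝ} :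
    A ∈ symMatricesOf G ↔ A.IsSymm ∧ ∀ i j, i ≠ j → (A i j ≠ 0 ↔ G.Adj i j) := by
  refine and_congr_right fun hA => ⟨?_, fun h => ?_⟩
  · rintro rfl i j hij
    simp [matrixGraph, SimpleGraph.fromRel_adj, hij, hA.apply i j]
  · ext i j
    rw [matrixGraph, SimpleGraph.fromRel_adj, hA.apply i j, or_self]
    exact ⟨fun ⟨hij, h0⟩ => (h i j hij).1 h0, fun hG => ⟨hG.ne, (h i j hG.ne).2 hG⟩⟩

theorem hasSSP_iff_isStrong {V : Type*} [Fintype V] [DecidableEq V] {G : SimpleGraph V}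
    {A : Matrix V V ℝ} (hA : A ∈ symMatricesOf G) :
    HasSSP A ↔ IsStrong (fun i j => i = j ∨ G.Adj i j) A := by
  obtain ⟨hs, hG⟩ := mem_symMatricesOf_iff.1 hA
  rw [HasSSP, and_iff_right hs]
  refine forall_congr' fun X => imp_congr_right fun hX => ?_
  have h1 : (A ⊙ X = 0 ∧ (1 : Matrix V V ℝ) ⊙ X = 0) ↔
      ∀ i j, i = j ∨ G.Adj i j → X i j = 0 := by
    constructor
    · rintro ⟨hAX, hIX⟩ i j (rfl | hij)
      · simpa using congrFun (congrFun hIX i) i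
      · have := congrFun (congrFun hAX i) j
        exact (mul_eq_zero.1 this).resolve_left ((hG i j hij.ne).2 hij)
    · intro h
      constructor <;> ext i j
      · by_cases hij : i = j
        · simp [h i j (Or.inl hij)]
        · by_cases h0 : A i j = 0
          · simp [h0]
          · simp [h i j (Or.inr ((hG i j hij).1 h0))]
      · by_cases hij : i = j
        · simp [h i j (Or.inl hij)]
        · simp [hij]
  rw [← h1, and_imp, Ring.lie_def, sub_eq_zero]

/-! ### Appending a vertex: bordered matrices. -/

section Append

variable {n : ℕ}

theorem appendVertex_adj_castSucc_castSucc (G : SimpleGraph (Fin n)) (α : Finset (Fin n))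
    (a b : Fin n) : (appendVertex G α).Adj a.castSucc b.castSucc ↔ G.Adj a b := by
  simp [appendVertex, Fin.castSucc_ne_last]

theorem appendVertex_adj_castSucc_last (G : SimpleGraph (Fin n)) (α : Finset (Fin n))
    (a : Fin n) : (appendVertex G α).Adj a.castSucc (Fin.last n) ↔ a ∈ α := by
  simp [appendVertex, Fin.castSucc_ne_last, (Fin.castSucc_ne_last _).symm]

/-- The matrix on `Fin (n + 1)` with the four given blocks. -/
def bordered (A : Matrix (Fin n) (Fin n) ℝ) (u v : Fin n → ℝ) (c : ℝ) :
    Matrix (Fin (n + 1)) (Fin (n + 1)) ℝ :=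
  Matrix.reindex finSumFinEquiv finSumFinEquiv
    (Matrix.fromBlocks A (.of fun i _ => u i) (.of fun _ j => v j)
      (.of fun _ _ => c : Matrix (Fin 1) (Fin 1) ℝ))

variable (A : Matrix (Fin n) (Fin n) ℝ) (u v : Fin n → ℝ) (c : ℝ)

@[simp] theorem bordered_castSucc_castSucc (a b : Fin n) :
    bordered A u v c a.castSucc b.castSucc = A a b := by
  simp [bordered]

@[simp] theorem bordered_castSucc_last (a : Fin n) :
    bordered A u v c a.castSucc (Fin.last n) = u a := by
  simp [bordered]

@[simp] theorem bordered_last_castSucc (b : Fin n) :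
    bordered A u v c (Fin.last n) b.castSucc = v b := by
  simp [bordered]

@[simp] theorem bordered_last_last :
    bordered A u v c (Fin.last n) (Fin.last n) = c := by
  simp [bordered]

theorem charpoly_bordered_zero :
    (bordered A 0 0 c).charpoly = A.charpoly * (Polynomial.X - Polynomial.C c) := by
  have h : (.of fun i _ => (0 : Fin n → ℝ) i : Matrix (Fin n) (Fin 1) ℝ) = 0 := rfl
  rw [bordered, Matrix.charpoly_reindex, h, Matrix.charpoly_fromBlocks_zero₁₂]
  simp [Matrix.charpoly, Matrix.charmatrix]

theorem eigMult_bordered_zero (μ : ℝ) :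
    eigMult (bordered A 0 0 c) μ = eigMult A μ + if μ = c then 1 else 0 := by
  have hA := A.charpoly_monic.ne_zero
  rw [eigMult, charpoly_bordered_zero, Polynomial.rootMultiplicity_mul
    (mul_ne_zero hA (Polynomial.X_sub_C_ne_zero c)), Polynomial.rootMultiplicity_X_sub_C, eigMult]

variable {A}

theorem isSymm_bordered (hA : A.IsSymm) : (bordered A u u c).IsSymm := by
  ext i j
  refine Fin.lastCases ?_ (fun a => ?_) i <;> refine Fin.lastCases ?_ (fun b => ?_) j <;>
    simp [hA.apply]

/-- In a commuting X, the old block commutes with A and the last column is in the c-eigenspace of A;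
the pattern kills the former by strength of A and the latter because it vanishes on `α`. -/
theorem isStrong_bordered {G : SimpleGraph (Fin n)} {α : Finset (Fin n)}
    (hA : IsStrong (fun i j => i = j ∨ G.Adj i j) A)
    (hα : ∀ x, A *ᵥ x = c • x → (∀ a ∈ α, x a = 0) → x = 0) :
    IsStrong (fun i j => i = j ∨ (appendVertex G α).Adj i j) (bordered A 0 0 c) := by
  intro X hXs hXr hcomm
  have hY : (X.submatrix Fin.castSucc Fin.castSucc) = 0 := by
    refine hA _ (by ext a b; exact hXs.apply _ _) (fun a b hab => hXr _ _ ?_) ?_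
    · exact hab.imp (congrArg _) (appendVertex_adj_castSucc_castSucc G α a b).2
    · ext a b
      have := congrFun (congrFun hcomm a.castSucc) b.castSucc
      simpa [Matrix.mul_apply, Fin.sum_univ_castSucc] using this
  have hx : (fun a : Fin n => X a.castSucc (Fin.last n)) = 0 := by
    refine hα _ ?_ fun a ha => hXr _ _ (Or.inr ((appendVertex_adj_castSucc_last G α a).2 ha))
    ext a
    have := congrFun (congrFun hcomm a.castSucc) (Fin.last n)
    simpa [Matrix.mul_apply, Matrix.mulVec, dotProduct, Fin.sum_univ_castSucc, mul_comm c]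
      using this
  ext i j
  refine Fin.lastCases ?_ (fun a => ?_) i <;> refine Fin.lastCases ?_ (fun b => ?_) j
  · exact hXr _ _ (Or.inl rfl)
  · rw [← hXs.apply]; exact congrFun hx b
  · exact congrFun hx a
  · exact congrFun (congrFun hY a) b

theorem commutator_bordered_zero {A : Matrix (Fin n) (Fin n) ℝ} (hA : A.IsSymm) (c : ℝ)
    (u : Fin n → ℝ) :
    bordered A 0 0 c * (bordered 0 u 0 0 - (bordered 0 u 0 0)ᵀ) -
      (bordered 0 u 0 0 - (bordered 0 u 0 0)ᵀ) * bordered A 0 0 c =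
    bordered 0 (A *ᵥ u - c • u) (A *ᵥ u - c • u) 0 := by
  ext i j
  refine Fin.lastCases ?_ (fun a => ?_) i <;> refine Fin.lastCases ?_ (fun b => ?_) j <;>
    simp [Matrix.mul_apply, Matrix.mulVec, dotProduct, Fin.sum_univ_castSucc, mul_comm c]
  rw [neg_add_eq_sub, sub_left_inj]
  exact Finset.sum_congr rfl fun d _ => by rw [hA.apply, mul_comm]

end Append

end IEPG

/-! ### The Augmentation Lemma. -/

open Filter Topology IEPG in
theorem mainTheorem8 (n : ℕ) (G : SimpleGraph (Fin n)) (A : Matrix (Fin n) (Fin n) ℝ)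
    (hA : A ∈ IEPG.symMatricesOf G) (hSSP : IEPG.HasSSP A)
    (lam : ℝ) (k : ℕ) (hk : 1 ≤ k) (hlam : IEPG.eigMult A lam = k)
    (α : Finset (Fin n)) (hcard : α.card = k + 1)
    (hα : ∀ x : Fin n → ℝ, Module.End.HasEigenvector (Matrix.toLin' A) lam x →
      2 ≤ (Function.support x ∩ (α : Set (Fin n))).ncard) :
    ∃ A' ∈ IEPG.symMatricesOf (IEPG.appendVertex G α),
      IEPG.HasSSP A' ∧ IEPG.eigMult A' lam = k + 1 ∧
        ∀ μ : ℝ, μ ≠ lam → IEPG.eigMult A' μ = IEPG.eigMult A μ := by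
  obtain ⟨hs, hG⟩ := mem_symMatricesOf_iff.1 hA
  set H := appendVertex G α
  set r : Fin (n + 1) → Fin (n + 1) → Prop := fun i j => i = j ∨ H.Adj i j with hrdef
  have hr : ∀ i j, r i j → r j i := fun i j h => h.imp Eq.symm fun h => h.symm
  have hmem : ∀ x, x ∈ Module.End.eigenspace (Matrix.toLin' A) lam ↔ A *ᵥ x = lam • x := fun x => by
    rw [Module.End.mem_eigenspace_iff, Matrix.toLin'_apply]
  have hstrong : IsStrong r (bordered A 0 0 lam) := by
    refine isStrong_bordered lam ((hasSSP_iff_isStrong hA).1 hSSP) fun x hx hxα => ?_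
    by_contra hne
    have h2 := hα x ⟨(hmem x).2 hx, hne⟩
    have h0 : Function.support x ∩ (α : Set (Fin n)) = ∅ := by
      ext a
      simpa using fun h1 h2 => h1 (hxα a h2)
    rw [h0, Set.ncard_empty] at h2
    omega
  obtain ⟨w, hwα, hw⟩ := exists_orthogonal_support_eq
    (Module.End.eigenspace (Matrix.toLin' A) lam) α
    (by rw [finrank_eigenspace_toLin' hs, hlam, hcard]) fun x hx hne => hα x ⟨hx, hne⟩
  obtain ⟨u, hu⟩ : ∃ u, (A - lam • (1 : Matrix (Fin n) (Fin n) ℝ)) *ᵥ u = w := by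
    refine exists_mulVec_eq_of_orthogonal_ker
      (hs.sub (Matrix.isSymm_one.smul lam)) fun x hx => hw x ((hmem x).2 ?_)
    rwa [Matrix.sub_mulVec, Matrix.smul_mulVec, Matrix.one_mulVec, sub_eq_zero] at hx
  rw [Matrix.sub_mulVec, Matrix.smul_mulVec, Matrix.one_mulVec] at hu
  have hD := commutator_bordered_zero hs lam u
  rw [hu] at hD
  obtain ⟨γ, hγ0, hγd, hγ⟩ := hstrong.exists_isospectral_curve hr (isSymm_bordered 0 lam hs)
    (fun i j => by
      refine Fin.lastCases ?_ (fun a => ?_) i <;> refine Fin.lastCases ?_ (fun b => ?_) j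
      · simp [hrdef]
      · simp
      · simp
      · intro h
        rw [hrdef, not_or] at h
        rw [bordered_castSucc_castSucc]
        by_contra h0
        exact h.2 ((appendVertex_adj_castSucc_castSucc G α a b).2
          ((hG a b fun h' => h.1 (congrArg _ h')).1 h0)))
    (bordered 0 u 0 0)
    (fun i j => by
      rw [hD]
      have key : ∀ a, ¬ r a.castSucc (Fin.last n) → w a = 0 := fun a ha => by
        by_contra h0
        exact ha (Or.inr ((appendVertex_adj_castSucc_last G α a).2 ((hwα a).1 h0)))
      refine Fin.lastCases ?_ (fun a => ?_) i <;> refine Fin.lastCases ?_ (fun b => ?_) j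
      · simp
      · rw [bordered_last_castSucc]
        exact fun h => key b fun h' => h (hr _ _ h')
      · rw [bordered_castSucc_last]
        exact key a
      · simp)
  rw [hD] at hγd
  have hstr := hstrong.eventually γ hγ0 fun i j => (hγd i j).continuousAt
  -- These entries vanish at t = 0 but have derivative w a ≠ 0, hence the punctured neighbourhood.
  have hnew : ∀ᶠ t in 𝓝[≠] (0 : ℝ), ∀ a ∈ α, γ t a.castSucc (Fin.last n) ≠ 0 := by
    refine (Filter.eventually_all_finset α).2 fun a ha => ?_
    exact (hγd a.castSucc (Fin.last n)).eventually_ne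
      (by rw [bordered_castSucc_last]; exact (hwα a).2 ha)
  have hold : ∀ᶠ t in 𝓝 (0 : ℝ), ∀ a b, G.Adj a b → γ t a.castSucc b.castSucc ≠ 0 := by
    refine Filter.eventually_all.2 fun a => Filter.eventually_all.2 fun b => ?_
    by_cases hab : G.Adj a b
    · have h0 : γ 0 a.castSucc b.castSucc ≠ 0 := by
        rw [hγ0, bordered_castSucc_castSucc]
        exact (hG a b hab.ne).2 hab
      filter_upwards [(hγd a.castSucc b.castSucc).continuousAt.eventually_ne h0] with t ht _
      exact ht
    · exact Filter.Eventually.of_forall fun t h => absurd h hab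
  obtain ⟨t, ⟨⟨hts, htr, htc⟩, htS, hto⟩, htn⟩ :=
    (((hγ.and (hstr.and hold)).filter_mono nhdsWithin_le_nhds).and hnew).exists
  have hmemH : γ t ∈ symMatricesOf H := by
    refine mem_symMatricesOf_iff.2 ⟨hts, fun i j hij => ⟨fun h0 => ?_, ?_⟩⟩
    · by_contra h
      exact h0 (htr i j (not_or.2 ⟨hij, h⟩))
    · rintro (⟨a, b, hab, rfl, rfl⟩ | ⟨a, ha, rfl, rfl⟩ | ⟨b, hb, rfl, rfl⟩)
      · exact hto a b hab
      · exact htn a ha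
      · rw [← hts.apply]; exact htn b hb
  have hmult : ∀ μ, eigMult (γ t) μ = eigMult A μ + if μ = lam then 1 else 0 := fun μ => by
    rw [← eigMult_bordered_zero, eigMult, htc, eigMult]
  refine ⟨γ t, hmemH, (hasSSP_iff_isStrong hmemH).2 htS, ?_, fun μ hμ => ?_⟩
  · rw [hmult, hlam, if_pos rfl]
  · rw [hmult, if_neg hμ, add_zero]
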